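/- Let $\mathbf a=(a_1,a_2,\ldots)$ and $\mathbf e=(e_1,e_2,\ldots)$ be sequences of real numbers, either both infinite or both finite of the same length $n$, and suppose that $\mathbf a$ is non-decreasing. Let $S^{\mathbf a,\mathbf e}$ be the matrix with rows and columns indexed by $\{0,1,2,\ldots\}$ in the infinite case and by $\{0,1,\ldots,n\}$ in the finite case, whose entries $S^{\mathbf a,\mathbf e}(m,k)$ with $k\le m$ are determined by $$\prod_{i=1}^m (x-e_i)=\sum_{k=0}^m S^{\mathbf a,\mathbf e}(m,k)\prod_{i=1}^k (x-a_i)$$ and whose entries with $k>m$ are $0$. A matrix (finite or infinite) is totally non-negative if all its minors (determinants of finite square submatrices) are non-negative. The sequence $\mathbf e$ is a restricted growth sequence relative to $\mathbf a$ if $e_i\le a_{f(i)}$ for each $i\ge 1$ (with $i\le n$ in the finite case), where $f(1)=1$ and, for $i\ge1$, $f(i+1)=f(i)$ if $e_i<a_{f(i)}$ and $f(i+1)=f(i)+1$ if $e_i=a_{f(i)}$. (If $e_i>a_{f(i)}$ for some $i$, then $\mathbf e$ is not a restricted growth sequence, and $f$ need not be defined beyond $i$.) Then: 1. $S^{\mathbf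 a,\mathbf e}$ is totally non-negative if and only if $\mathbf e$ is a restricted growth sequence relative to $\mathbf a$. 2. If $\mathbf e$ is not a restricted growth sequence relative to $\mathbf a$, then $S^{\mathbf a,\mathbf e}$ has a negative entry. -/

import Mathlib

open Polynomial

/-- Positions in a sequence of length `N`, where `N = ⊤` means an infinite sequence. Positions are
counted from `0`, so position `i` carries the `(i + 1)`-st term. -/
abbrev SeqIdx (N : ℕ∞) : Type := {i : ℕ // (i : ℕ∞) < N}

/-- The row and column labels `0, 1, …, N` (all natural numbers if `N = ⊤`). -/
abbrev MatIdx (N : ℕ∞) : Type := {m : ℕ // (m : ℕ∞) ≤ N}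

theorem SeqIdx.lt_of_lt {N : ℕ∞} {i m : ℕ} (h : i < m) (hm : (m : ℕ∞) ≤ N) : (i : ℕ∞) < N :=
  lt_of_lt_of_le (Nat.cast_lt.2 h) hm

theorem SeqIdx.lt_of_le {N : ℕ∞} {j n : ℕ} (h : j ≤ n) (hn : (n : ℕ∞) < N) : (j : ℕ∞) < N :=
  lt_of_le_of_lt (Nat.cast_le.2 h) hn

theorem MatIdx.le_of_lt_succ {N : ℕ∞} {k m : ℕ} (h : k < m + 1) (hm : (m : ℕ∞) ≤ N) :
    (k : ℕ∞) ≤ N :=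
  le_trans (Nat.cast_le.2 (Nat.lt_succ_iff.1 h)) hm

/-- The polynomial `(x - c₁) ⋯ (x - cₘ)`. -/
noncomputable def rootProd {N : ℕ∞} (c : SeqIdx N → ℝ) (m : MatIdx N) : ℝ[X] :=
  ∏ i : Fin m.1, (X - C (c ⟨i.1, SeqIdx.lt_of_lt i.2 m.2⟩))

/-- `S` is the lower triangular matrix whose `m`-th row holds the coefficients of
`(x - e₁) ⋯ (x - eₘ)` with respect to `1, x - a₁, …, (x - a₁) ⋯ (x - aₘ)`. -/
def IsConnectionMatrix {N : ℕ∞} (a e : SeqIdx N → ℝ) (S : Matrix (MatIdx N) (MatIdx N) ℝ) : Prop :=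
  (∀ m : MatIdx N, rootProd e m =
      ∑ k : Fin (m.1 + 1),
        C (S m ⟨k.1, MatIdx.le_of_lt_succ k.2 m.2⟩) *
          rootProd a ⟨k.1, MatIdx.le_of_lt_succ k.2 m.2⟩) ∧
    ∀ m k : MatIdx N, m < k → S m k = 0

theorem rootProd_monic {N : ℕ∞} (c : SeqIdx N → ℝ) (m : MatIdx N) : (rootProd c m).Monic :=
  monic_prod_of_monic _ _ fun _ _ => monic_X_sub_C _

theorem rootProd_natDegree {N : ℕ∞} (c : SeqIdx N → ℝ) (m : MatIdx N) :
    (rootProd c m).natDegree = m.1 := by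
  unfold rootProd
  rw [natDegree_prod_of_monic _ _ fun _ _ => monic_X_sub_C _]
  simp

theorem existsUnique_expansion (n : ℕ) : ∀ (b : Fin n → ℝ[X]),
    (∀ i, (b i).Monic) → (∀ i, (b i).natDegree = i.1) → ∀ p : ℝ[X], p.degree < n →
      ∃! c : Fin n → ℝ, p = ∑ i, C (c i) * b i := by
  induction n with
  | zero =>
    intro b _ _ p hp
    refine ⟨fun _ => 0, ?_, fun c _ => Subsingleton.elim _ _⟩
    have hp0 : p = 0 := by
      rw [← degree_eq_bot]
      exact Nat.WithBot.lt_zero_iff.1 (by simpa using hp)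
    simp [hp0]
  | succ n ih =>
    intro b hb hd p hp
    have hsmall : ∀ c : Fin n → ℝ, (∑ i, C (c i) * b i.castSucc).coeff n = 0 := by
      intro c
      rw [finsetSum_coeff]
      refine Finset.sum_eq_zero fun i _ => ?_
      rw [coeff_C_mul, coeff_eq_zero_of_natDegree_lt (by rw [hd]; exact i.2), mul_zero]
    have htop : (b (Fin.last n)).coeff n = 1 := by
      have h := hb (Fin.last n)
      rw [Monic, leadingCoeff, hd] at h
      simpa using h
    have hq : (p - C (p.coeff n) * b (Fin.last n)).degree < n := by
      rw [degree_lt_iff_coeff_zero]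
      intro m hm
      rcases hm.eq_or_lt with rfl | hm
      · simp [htop]
      · rw [coeff_sub, coeff_C_mul, coeff_eq_zero_of_degree_lt (p := p)
            (lt_of_lt_of_le hp (by exact_mod_cast hm)),
          coeff_eq_zero_of_natDegree_lt (p := b (Fin.last n)) (by rw [hd]; simpa using hm)]
        simp
    obtain ⟨c, hc, hu⟩ := ih (fun i => b i.castSucc) (fun i => hb _) (fun i => by simp [hd]) _ hq
    refine ⟨Fin.snoc c (p.coeff n), ?_, ?_⟩
    · simp only [Fin.sum_univ_castSucc, Fin.snoc_castSucc, Fin.snoc_last]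
      rw [← hc]
      ring
    · intro d hd'
      have hd2 : p = ∑ i, C (d i) * b i := hd'
      rw [Fin.sum_univ_castSucc] at hd2
      have hl : d (Fin.last n) = p.coeff n := by
        have h := congrArg (fun q => q.coeff n) hd2
        simp only [coeff_add] at h
        rw [hsmall (fun i => d i.castSucc), coeff_C_mul, htop] at h
        linarith
      have hi : (fun i => d i.castSucc) = c := by
        apply hu
        rw [← hl]
        exact sub_eq_of_eq_add hd2
      funext i
      refine Fin.lastCases ?_ (fun i => ?_) i
      · rw [hl, Fin.snoc_last]
      · rw [Fin.snoc_castSucc, ← hi]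

theorem existsUnique_isConnectionMatrix {N : ℕ∞} (a e : SeqIdx N → ℝ) :
    ∃! S : Matrix (MatIdx N) (MatIdx N) ℝ, IsConnectionMatrix a e S := by
  have key : ∀ m : MatIdx N, ∃! c : Fin (m.1 + 1) → ℝ, rootProd e m =
      ∑ k, C (c k) * rootProd a ⟨k.1, MatIdx.le_of_lt_succ k.2 m.2⟩ := by
    intro m
    refine existsUnique_expansion (m.1 + 1)
      (fun k => rootProd a ⟨k.1, MatIdx.le_of_lt_succ k.2 m.2⟩)
      (fun _ => rootProd_monic _ _) (fun _ => rootProd_natDegree _ _) _ ?_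
    refine lt_of_le_of_lt degree_le_natDegree ?_
    rw [rootProd_natDegree]
    exact_mod_cast Nat.lt_succ_self m.1
  choose c hc hu using key
  refine ⟨fun m k => if h : k.1 < m.1 + 1 then c m ⟨k.1, h⟩ else 0, ⟨?_, ?_⟩, ?_⟩
  · intro m
    refine (hc m).trans (Finset.sum_congr rfl fun k _ => ?_)
    simp [k.2]
  · intro m k hmk
    have h : m.1 < k.1 := hmk
    have h' : ¬ k.1 < m.1 + 1 := by omega
    simp [h']
  · intro T hT
    funext m k
    by_cases h : k.1 < m.1 + 1
    · have h1 := congrFun (hu m (fun k => T m ⟨k.1, MatIdx.le_of_lt_succ k.2 m.2⟩) (hT.1 m)) ⟨k.1, h⟩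
      simpa [h] using h1
    · have h2 : m < k := show m.1 < k.1 by omega
      simp [h, hT.2 m k h2]

/-- The matrix `S^{a,e}`: the unique lower triangular matrix with
`(x - e₁) ⋯ (x - eₘ) = ∑_{k ≤ m} S^{a,e}(m, k) (x - a₁) ⋯ (x - aₖ)` for every row label `m`. -/
noncomputable def connectionMatrix {N : ℕ∞} (a e : SeqIdx N → ℝ) :
    Matrix (MatIdx N) (MatIdx N) ℝ :=
  Classical.choose (existsUnique_isConnectionMatrix a e)

theorem connectionMatrix_spec {N : ℕ∞} (a e : SeqIdx N → ℝ) :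
    IsConnectionMatrix a e (connectionMatrix a e) :=
  (Classical.choose_spec (existsUnique_isConnectionMatrix a e)).1

theorem connectionMatrix_unique {N : ℕ∞} {a e : SeqIdx N → ℝ}
    {S : Matrix (MatIdx N) (MatIdx N) ℝ} (hS : IsConnectionMatrix a e S) :
    S = connectionMatrix a e :=
  (Classical.choose_spec (existsUnique_isConnectionMatrix a e)).2 S hS

/-- A real matrix, finite or infinite, is totally non-negative if all its minors are `≥ 0`: for all
choices of `r` rows and `r` columns, each listed in increasing order. -/
def IsTotallyNonneg {ι κ : Type*} [Preorder ι] [Preorder κ] (M : Matrix ι κ ℝ) : Prop :=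
  ∀ (r : ℕ) (p : Fin r → ι) (q : Fin r → κ), StrictMono p → StrictMono q →
    0 ≤ (M.submatrix p q).det

open Classical in
/-- The position of the cap: it starts at the first term of `a`, stays put as long as the term of
`e` is below the cap, and advances by one when the term of `e` meets the cap. (The branch `else`
also covers a term of `e` above its cap, when later positions no longer matter: then `e` is not a
restricted growth sequence anyway.) -/
noncomputable def capIdx {N : ℕ∞} (a e : SeqIdx N → ℝ) :
    (n : ℕ) → (n : ℕ∞) < N → {j : ℕ // j ≤ n}
  | 0, _ => ⟨0, le_rfl⟩
  | n + 1, h =>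
    have hn : (n : ℕ∞) < N := SeqIdx.lt_of_le n.le_succ h
    let j := capIdx a e n hn
    if e ⟨n, hn⟩ < a ⟨j.1, SeqIdx.lt_of_le j.2 hn⟩ then
      ⟨j.1, j.2.trans n.le_succ⟩
    else
      ⟨j.1 + 1, Nat.succ_le_succ j.2⟩

/-- `e` is a restricted growth sequence relative to `a`: each term of `e` is at most its cap. -/
def IsRestrictedGrowth {N : ℕ∞} (a e : SeqIdx N → ℝ) : Prop :=
  ∀ i : SeqIdx N, e i ≤
    a ⟨(capIdx a e i.1 i.2).1, SeqIdx.lt_of_le (capIdx a e i.1 i.2).2 i.2⟩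

/-!
Expand the `m`-th product `(x - e₁) ⋯ (x - eₘ)` in the Newton basis of `a`. Multiplication by `x - c`
acts on Newton coefficients by `newtonMul a c`, and these operators commute, so the first factor
`x - e₁` may be split off instead of the last one (`newtonCoeff_succ'`). This peels the matrix:

* if `e₁ < a₁`, then `S^{a,e}` is `1 ⊕ S^{a,e'}` times the bidiagonal matrix with ones on the diagonal
  and the entries `aₖ - e₁ ≥ 0` below it, where `e' = (e₂, e₃, …)`;
* if `e₁ = a₁`, then `S^{a,e} = 1 ⊕ S^{a',e'}`, where also `a' = (a₂, a₃, …)`.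

In both cases the shifted sequences have restricted growth again, so total non-negativity follows by
induction on the number of rows. Bordering by a `1` (`IsTotallyNonneg.of_border`) and adding to each
column a non-negative multiple of the next one (`IsTotallyNonneg.add_mul_next_col`) preserve total
non-negativity; for the latter the minor is expanded multilinearly, and every term is a minor of the
original matrix or has two equal columns.

Conversely, let `eᵢ` be the first term above its cap `a_f`. The roots met so far make
`(x - e₁) ⋯ (x - eᵢ₋₁)` divisible by `∏_{j < f} (x - aⱼ)`, so the row before the offending term
vanishes to the left of the column of the cap, and it is positive there (`newtonCoeff_cap`). In the
next row, the entry of this column is that positive one times `a_f - eᵢ < 0`.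
-/

/-! ### Operations preserving total non-negativity -/

theorem IsTotallyNonneg.add_mul_next_col {ι : Type*} [Preorder ι] {M : Matrix ι ℕ ℝ}
    (hM : IsTotallyNonneg M) {c : ℕ → ℝ} (hc : ∀ k, 0 ≤ c k) :
    IsTotallyNonneg (Matrix.of fun i k => M i k + c k * M i (k + 1)) := by
  classical
  intro r p q hp hq
  rw [← Matrix.det_transpose]
  have hsum : ((Matrix.of fun i k => M i k + c k * M i (k + 1)).submatrix p q).transpose =
      (fun j i => c (q j) * M (p i) (q j + 1)) + fun j i => M (p i) (q j) := by
    ext j i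
    simp [add_comm]
  change 0 ≤ Matrix.detRowAlternating.toMultilinearMap _
  rw [hsum, MultilinearMap.map_add_univ]
  refine Finset.sum_nonneg fun s _ => ?_
  -- the columns chosen by the subset `s`: the next column for `j ∈ s`, the original one otherwise
  set q' : Fin r → ℕ := fun j => if j ∈ s then q j + 1 else q j with hq'
  have hterm : (s.piecewise (fun j i => c (q j) * M (p i) (q j + 1)) fun j i => M (p i) (q j)) =
      fun j => (if j ∈ s then c (q j) else 1) • fun i => M (p i) (q' j) := by
    funext j i
    by_cases h : j ∈ s <;> simp [h, hq']
  rw [hterm, MultilinearMap.map_smul_univ, smul_eq_mul]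
  refine mul_nonneg (Finset.prod_nonneg fun j _ => by split_ifs <;> simp [hc]) ?_
  change 0 ≤ (M.submatrix p q').transpose.det
  rw [Matrix.det_transpose]
  have hmono : Monotone q' := by
    intro i j hij
    rcases hij.eq_or_lt with rfl | hij
    · rfl
    · have := hq hij
      simp only [hq']
      split_ifs <;> omega
  by_cases hinj : Function.Injective q'
  · exact hM r p q' hp (hmono.strictMono_of_injective hinj)
  · simp only [Function.Injective, not_forall] at hinj
    obtain ⟨i, j, hij, hne⟩ := hinj
    exact (Matrix.det_zero_of_column_eq hne fun k => by simp [hij]).ge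

theorem IsTotallyNonneg.of_border {n : ℕ} {M : Matrix (Fin (n + 1)) ℕ ℝ} (h00 : M 0 0 = 1)
    (hrow : ∀ k, M 0 (k + 1) = 0) (hcol : ∀ i : Fin n, M i.succ 0 = 0)
    (hM : IsTotallyNonneg (Matrix.of fun (i : Fin n) k => M i.succ (k + 1))) :
    IsTotallyNonneg M := by
  have hpos : ∀ (r : ℕ) (p : Fin r → Fin (n + 1)) (q : Fin r → ℕ), StrictMono p → StrictMono q →
      (∀ i, p i ≠ 0) → (∀ i, q i ≠ 0) → 0 ≤ (M.submatrix p q).det := by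
    intro r p q hp hq hp0 hq0
    convert hM r (fun i => (p i).pred (hp0 i)) (fun i => q i - 1)
      (fun i j hij => Fin.pred_lt_pred_iff.2 (hp hij))
      (fun i j hij => by have := hq hij; have := hq0 i; simp only; omega) using 2
    ext i j
    simp [Nat.sub_add_cancel (Nat.pos_of_ne_zero (hq0 j))]
  intro r p q hp hq
  cases r with
  | zero => simp
  | succ r =>
    have hp0 : ∀ i : Fin r, p i.succ ≠ 0 := fun i h => by
      have := hp (Fin.succ_pos i)
      simp [h] at this
    have hq0 : ∀ i : Fin r, q i.succ ≠ 0 := fun i h => by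
      have := hq (Fin.succ_pos i)
      omega
    have hcol' : ∀ i, i ≠ 0 → M i 0 = 0 := fun i hi => by
      rw [← Fin.succ_pred i hi, hcol]
    have hrow' : ∀ k, k ≠ 0 → M 0 k = 0 := fun k hk => by
      obtain ⟨k, rfl⟩ := Nat.exists_eq_succ_of_ne_zero hk
      exact hrow k
    by_cases hp1 : p 0 = 0 <;> by_cases hq1 : q 0 = 0
    · rw [Matrix.det_succ_row_zero, Fin.sum_univ_succ]
      have hz : ∀ j : Fin r, M 0 (q j.succ) = 0 := fun j => hrow' _ (hq0 j)
      simp only [Matrix.submatrix_apply, hp1, hq1, hz, h00]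
      simp only [mul_zero, zero_mul, Finset.sum_const_zero, add_zero, Fin.val_zero, pow_zero,
        one_mul, Matrix.submatrix_submatrix, Fin.succAbove_zero]
      exact hpos r _ _ (hp.comp (Fin.strictMono_succ)) (hq.comp (Fin.strictMono_succ)) hp0 hq0
    · refine (Matrix.det_eq_zero_of_row_eq_zero 0 fun j => ?_).ge
      rw [Matrix.submatrix_apply, hp1]
      refine hrow' _ fun h => ?_
      have := hq.monotone (Fin.zero_le j)
      omega
    · refine (Matrix.det_eq_zero_of_column_eq_zero 0 fun j => ?_).ge
      rw [Matrix.submatrix_apply, hq1]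
      refine hcol' _ fun h => hp1 ?_
      have := hp.monotone (Fin.zero_le j)
      rw [h] at this
      exact le_antisymm this (Fin.zero_le _)
    · refine hpos _ p q hp hq (Fin.cases hp1 hp0) (Fin.cases hq1 hq0)

/-! ### Coefficients in the Newton basis -/

/-- The effect of multiplication by `x - c` on the coefficients `v` of a polynomial with respect to
the Newton basis `1, x - a₀, (x - a₀)(x - a₁), …`. -/
def newtonMul (a : ℕ → ℝ) (c : ℝ) (v : ℕ → ℝ) : ℕ → ℝ
  | 0 => (a 0 - c) * v 0
  | k + 1 => v k + (a (k + 1) - c) * v (k + 1)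

/-- The `k`-th coefficient of `(x - e₀) ⋯ (x - eₘ₋₁)` with respect to the Newton basis of `a`. The
sequences are indexed by all natural numbers; row `m` depends only on their terms below `m`. -/
def newtonCoeff (a e : ℕ → ℝ) : ℕ → ℕ → ℝ
  | 0 => Pi.single 0 1
  | m + 1 => newtonMul a (e m) (newtonCoeff a e m)

theorem newtonMul_comm (a : ℕ → ℝ) (c d : ℝ) (v : ℕ → ℝ) :
    newtonMul a c (newtonMul a d v) = newtonMul a d (newtonMul a c v) := by
  funext k
  rcases k with _ | _ | k <;> simp only [newtonMul] <;> ring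

/-- The recursion that splits off the first factor instead of the last one. -/
theorem newtonCoeff_succ' (a e : ℕ → ℝ) (m : ℕ) :
    newtonCoeff a e (m + 1) = newtonMul a (e 0) (newtonCoeff a (fun i => e (i + 1)) m) := by
  induction m with
  | zero => rfl
  | succ m ih => rw [newtonCoeff, ih, newtonMul_comm, newtonCoeff]

theorem newtonCoeff_eq_zero (a e : ℕ → ℝ) {m k : ℕ} (h : m < k) : newtonCoeff a e m k = 0 := by
  induction m generalizing k with
  | zero => simp [newtonCoeff, h.ne']
  | succ m ih =>
    obtain ⟨k, rfl⟩ := Nat.exists_eq_succ_of_ne_zero (Nat.ne_zero_of_lt h)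
    simp [newtonCoeff, newtonMul, ih (show m < k by omega), ih (show m < k + 1 by omega)]

theorem newtonCoeff_succ_zero_of_eq {a e : ℕ → ℝ} (h : e 0 = a 0) (m : ℕ) :
    newtonCoeff a e (m + 1) 0 = 0 := by
  simp [newtonCoeff_succ', newtonMul, h]

/-- A common first root cancels. -/
theorem newtonCoeff_succ_succ_of_eq {a e : ℕ → ℝ} (h : e 0 = a 0) (m k : ℕ) :
    newtonCoeff a e (m + 1) (k + 1) =
      newtonCoeff (fun i => a (i + 1)) (fun i => e (i + 1)) m k := by
  induction m generalizing k with
  | zero => rcases k with _ | k <;> simp [newtonCoeff, newtonMul]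
  | succ m ih =>
    rw [newtonCoeff, newtonMul, ih]
    rcases k with _ | k
    · rw [newtonCoeff_succ_zero_of_eq h, newtonCoeff, newtonMul, zero_add]
    · rw [ih, newtonCoeff.eq_2 (fun i => a (i + 1)), newtonMul]

theorem sum_newtonMul (a : ℕ → ℝ) (c : ℝ) (v : ℕ → ℝ) (m : ℕ) :
    ∑ k ∈ Finset.range (m + 1), C (newtonMul a c v k) * ∏ i ∈ Finset.range k, (X - C (a i)) =
      (X - C c) * (∑ k ∈ Finset.range m, C (v k) * ∏ i ∈ Finset.range k, (X - C (a i))) +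
        C ((a m - c) * v m) * ∏ i ∈ Finset.range m, (X - C (a i)) := by
  induction m with
  | zero => simp [newtonMul]
  | succ m ih =>
    rw [Finset.sum_range_succ, ih, Finset.sum_range_succ, newtonMul, Finset.prod_range_succ]
    simp only [C_add, C_mul, C_sub]
    ring

theorem prod_eq_sum_newtonCoeff (a e : ℕ → ℝ) (m : ℕ) :
    ∏ i ∈ Finset.range m, (X - C (e i)) =
      ∑ k ∈ Finset.range (m + 1), C (newtonCoeff a e m k) *
        ∏ i ∈ Finset.range k, (X - C (a i)) := by
  induction m with
  | zero => simp [newtonCoeff]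
  | succ m ih =>
    rw [newtonCoeff, sum_newtonMul, ← ih, newtonCoeff_eq_zero a e m.lt_succ_self,
      Finset.prod_range_succ]
    simp [mul_comm]

/-! ### Restricted growth and total non-negativity -/

/-- The position of the cap, for sequences indexed by all natural numbers. -/
noncomputable def cap (a e : ℕ → ℝ) : ℕ → ℕ
  | 0 => 0
  | n + 1 => if e n < a (cap a e n) then cap a e n else cap a e n + 1

theorem cap_le (a e : ℕ → ℝ) (n : ℕ) : cap a e n ≤ n := by
  induction n with
  | zero => rfl
  | succ n ih =>
    rw [cap]
    split_ifs <;> omega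

theorem cap_succ_of_lt {a e : ℕ → ℝ} (h : e 0 < a 0) (n : ℕ) :
    cap a e (n + 1) = cap a (fun i => e (i + 1)) n := by
  induction n with
  | zero => simp [cap, h]
  | succ n ih => rw [cap, ih, cap.eq_2 a fun i => e (i + 1)]

theorem cap_succ_of_eq {a e : ℕ → ℝ} (h : e 0 = a 0) (n : ℕ) :
    cap a e (n + 1) = cap (fun i => a (i + 1)) (fun i => e (i + 1)) n + 1 := by
  induction n with
  | zero => simp [cap, h]
  | succ n ih =>
    rw [cap, ih, cap.eq_2 (fun i => a (i + 1))]
    split_ifs <;> rfl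

theorem isTotallyNonneg_newtonCoeff (n : ℕ) (a e : ℕ → ℝ) (ha : MonotoneOn a (Set.Iio n))
    (he : ∀ i < n, e i ≤ a (cap a e i)) :
    IsTotallyNonneg (Matrix.of fun (m : Fin (n + 1)) k => newtonCoeff a e m k) := by
  induction n generalizing a e with
  | zero =>
    refine .of_border (by simp [newtonCoeff]) (fun k => by simp [newtonCoeff])
      (fun i => i.elim0) fun r p q _ _ => ?_
    rcases r with _ | r
    · simp
    · exact (p 0).elim0
  | succ n ih =>
    have h0 : e 0 ≤ a 0 := he 0 n.succ_pos
    rcases h0.eq_or_lt with h0 | h0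
    · refine .of_border (by simp [newtonCoeff]) (fun k => by simp [newtonCoeff])
        (fun i => by simp [newtonCoeff_succ_zero_of_eq h0]) ?_
      have := ih (fun i => a (i + 1)) (fun i => e (i + 1))
        (fun i hi j hj hij => ha (Nat.succ_lt_succ hi) (Nat.succ_lt_succ hj) (Nat.succ_le_succ hij))
        fun i hi => by
          have := he (i + 1) (Nat.succ_lt_succ hi)
          rwa [cap_succ_of_eq h0] at this
      convert this using 4
      simp [newtonCoeff_succ_succ_of_eq h0]
    · have h1 := ih a (fun i => e (i + 1))
        (ha.mono fun i (hi : i < n) => hi.trans n.lt_succ_self) fun i hi => by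
          have := he (i + 1) (Nat.succ_lt_succ hi)
          rwa [cap_succ_of_lt h0] at this
      let M : Matrix (Fin (n + 2)) ℕ ℝ := Matrix.of <| Fin.cons (Pi.single 0 1) fun i k =>
        Nat.casesOn k 0 fun k => newtonCoeff a (fun i => e (i + 1)) i k
      have hM : IsTotallyNonneg M := .of_border (by simp [M]) (fun k => by simp [M])
        (fun i => by simp [M]) (by simpa [M] using h1)
      -- columns beyond the range of `a` have a zero column next to them
      have h2 := hM.add_mul_next_col (c := fun k => if k < n + 1 then a k - e 0 else 0) fun k => by
        split_ifs with hk
        · have := ha (Set.mem_Iio.2 n.succ_pos) (Set.mem_Iio.2 hk) (Nat.zero_le k)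
          linarith
        · rfl
      convert h2 using 4 with m k
      refine Fin.cases ?_ (fun m => ?_) m
      · simp [M, newtonCoeff]
      · have hz : (a k - e 0) * newtonCoeff a (fun i => e (i + 1)) m k =
            (if k < n + 1 then a k - e 0 else 0) * newtonCoeff a (fun i => e (i + 1)) m k := by
          split_ifs with hk
          · rfl
          · rw [newtonCoeff_eq_zero _ _ (show m.1 < k by omega), mul_zero, mul_zero]
        rw [Fin.val_succ, newtonCoeff_succ']
        rcases k with _ | k <;> simp only [newtonMul, hz] <;> simp [M]

theorem newtonCoeff_nonneg {n : ℕ} {a e : ℕ → ℝ} (ha : MonotoneOn a (Set.Iio n))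
    (he : ∀ i < n, e i ≤ a (cap a e i)) (k : ℕ) : 0 ≤ newtonCoeff a e n k := by
  have := isTotallyNonneg_newtonCoeff n a e ha he 1 (fun _ => Fin.last n) (fun _ => k)
    (Subsingleton.strictMono _) (Subsingleton.strictMono _)
  simpa using this

/-- As long as the growth is restricted, row `n` vanishes to the left of the cap and is positive at
the cap. -/
theorem newtonCoeff_cap {n : ℕ} {a e : ℕ → ℝ} (ha : MonotoneOn a (Set.Iio n))
    (he : ∀ i < n, e i ≤ a (cap a e i)) :
    (∀ k < cap a e n, newtonCoeff a e n k = 0) ∧ 0 < newtonCoeff a e n (cap a e n) := by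
  induction n with
  | zero => simp [cap, newtonCoeff]
  | succ n ih =>
    have ha' : MonotoneOn a (Set.Iio n) := ha.mono fun i (hi : i < n) => hi.trans n.lt_succ_self
    have he' : ∀ i < n, e i ≤ a (cap a e i) := fun i hi => he i (hi.trans n.lt_succ_self)
    obtain ⟨hz, hp⟩ := ih ha' he'
    have hzero : ∀ k < cap a e n, newtonCoeff a e (n + 1) k = 0 := by
      intro k hk
      rcases k with _ | k
      · simp [newtonCoeff, newtonMul, hz 0 hk]
      · simp [newtonCoeff, newtonMul, hz k (by omega), hz (k + 1) hk]
    have hcap : newtonCoeff a e (n + 1) (cap a e n) =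
        (a (cap a e n) - e n) * newtonCoeff a e n (cap a e n) := by
      rw [newtonCoeff]
      rcases h : cap a e n with _ | k
      · rfl
      · rw [newtonMul, hz k (by omega), zero_add]
    rcases (he n n.lt_succ_self).eq_or_lt with h | h
    · rw [cap, if_neg h.not_lt]
      refine ⟨fun k hk => ?_, ?_⟩
      · rcases (Nat.lt_succ_iff.1 hk).eq_or_lt with rfl | hk
        · rw [hcap, h, sub_self, zero_mul]
        · exact hzero k hk
      · rw [newtonCoeff, newtonMul]
        refine add_pos_of_pos_of_nonneg hp ?_
        by_cases hc : cap a e n < n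
        · refine mul_nonneg ?_ (newtonCoeff_nonneg ha' he' _)
          rw [h, sub_nonneg]
          exact ha (Set.mem_Iio.2 (by omega)) (Set.mem_Iio.2 (by omega)) (Nat.le_succ _)
        · rw [newtonCoeff_eq_zero _ _ (by omega), mul_zero]
    · rw [cap, if_pos h]
      exact ⟨hzero, hcap ▸ mul_pos (sub_pos.2 h) hp⟩

theorem newtonCoeff_cap_neg {n : ℕ} {a e : ℕ → ℝ} (ha : MonotoneOn a (Set.Iio n))
    (he : ∀ i < n, e i ≤ a (cap a e i)) (hn : a (cap a e n) < e n) :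
    newtonCoeff a e (n + 1) (cap a e n) < 0 := by
  obtain ⟨hz, hp⟩ := newtonCoeff_cap ha he
  have h := mul_neg_of_neg_of_pos (sub_neg.2 hn) hp
  rw [newtonCoeff]
  rcases hk : cap a e n with _ | k <;> rw [hk] at h hz
  · exact h
  · rwa [newtonMul, hz k k.lt_succ_self, zero_add]

/-! ### Sequences of a given length -/

open Classical in
/-- The extension by zero of a sequence of length `N` to all natural numbers. -/
noncomputable def extendSeq {N : ℕ∞} (c : SeqIdx N → ℝ) (i : ℕ) : ℝ :=
  if h : (i : ℕ∞) < N then c ⟨i, h⟩ else 0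

theorem extendSeq_of_lt {N : ℕ∞} (c : SeqIdx N → ℝ) {i : ℕ} (h : (i : ℕ∞) < N) :
    extendSeq c i = c ⟨i, h⟩ := dif_pos h

theorem rootProd_eq {N : ℕ∞} (c : SeqIdx N → ℝ) (m : MatIdx N) :
    rootProd c m = ∏ i ∈ Finset.range m.1, (X - C (extendSeq c i)) := by
  rw [rootProd, Finset.prod_range]
  exact Finset.prod_congr rfl fun i _ => by rw [extendSeq_of_lt]

theorem connectionMatrix_apply {N : ℕ∞} (a e : SeqIdx N → ℝ) (m k : MatIdx N) :
    connectionMatrix a e m k = newtonCoeff (extendSeq a) (extendSeq e) m.1 k.1 := by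
  have h : IsConnectionMatrix a e
      (Matrix.of fun m k : MatIdx N => newtonCoeff (extendSeq a) (extendSeq e) m.1 k.1) := by
    refine ⟨fun m => ?_, fun m k hmk => newtonCoeff_eq_zero _ _ hmk⟩
    simp only [rootProd_eq, Matrix.of_apply]
    rw [prod_eq_sum_newtonCoeff (extendSeq a), Finset.sum_range]
  rw [← connectionMatrix_unique h, Matrix.of_apply]

theorem capIdx_eq {N : ℕ∞} (a e : SeqIdx N → ℝ) (n : ℕ) (hn : (n : ℕ∞) < N) :
    (capIdx a e n hn).1 = cap (extendSeq a) (extendSeq e) n := by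
  induction n with
  | zero => rfl
  | succ n ih =>
    have hn' : (n : ℕ∞) < N := SeqIdx.lt_of_le n.le_succ hn
    have hj := (capIdx a e n hn').2
    simp only [capIdx]
    rw [cap, ← ih hn', extendSeq_of_lt e hn', extendSeq_of_lt a (SeqIdx.lt_of_le hj hn')]
    split_ifs <;> rfl

theorem isRestrictedGrowth_iff {N : ℕ∞} (a e : SeqIdx N → ℝ) :
    IsRestrictedGrowth a e ↔ ∀ i : ℕ, (i : ℕ∞) < N →
      extendSeq e i ≤ extendSeq a (cap (extendSeq a) (extendSeq e) i) := by
  refine Subtype.forall.trans (forall₂_congr fun i hi => ?_)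
  rw [← capIdx_eq a e i hi, extendSeq_of_lt e hi,
    extendSeq_of_lt a (SeqIdx.lt_of_le (capIdx a e i hi).2 hi)]

theorem monotoneOn_extendSeq {N : ℕ∞} {a : SeqIdx N → ℝ} (ha : Monotone a) {n : ℕ}
    (hn : (n : ℕ∞) ≤ N) : MonotoneOn (extendSeq a) (Set.Iio n) := by
  intro i hi j hj hij
  rw [extendSeq_of_lt a (SeqIdx.lt_of_lt hi hn), extendSeq_of_lt a (SeqIdx.lt_of_lt hj hn)]
  exact ha hij

theorem IsRestrictedGrowth.isTotallyNonneg {N : ℕ∞} {a e : SeqIdx N → ℝ} (ha : Monotone a)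
    (he : IsRestrictedGrowth a e) : IsTotallyNonneg (connectionMatrix a e) := by
  rw [isRestrictedGrowth_iff] at he
  intro r p q hp hq
  rcases r with _ | r
  · simp
  -- only the rows up to the last chosen one matter
  have hlast : ((p (Fin.last r)).1 : ℕ∞) ≤ N := (p (Fin.last r)).2
  convert isTotallyNonneg_newtonCoeff (p (Fin.last r)).1 (extendSeq a) (extendSeq e)
    (monotoneOn_extendSeq ha hlast) (fun i hi => he i (SeqIdx.lt_of_lt hi hlast)) (r + 1)
    (fun i => ⟨(p i).1, Nat.lt_succ_of_le (hp.monotone (Fin.le_last i))⟩) (fun j => (q j).1)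
    (fun i j hij => hp hij) (fun i j hij => hq hij) using 2
  ext i j
  simp [connectionMatrix_apply]

theorem exists_connectionMatrix_neg {N : ℕ∞} {a e : SeqIdx N → ℝ} (ha : Monotone a)
    (he : ¬ IsRestrictedGrowth a e) : ∃ m k : MatIdx N, connectionMatrix a e m k < 0 := by
  classical
  rw [isRestrictedGrowth_iff] at he
  push Not at he
  obtain ⟨hnN, hn⟩ := Nat.find_spec he
  have hmin : ∀ i < Nat.find he,
      extendSeq e i ≤ extendSeq a (cap (extendSeq a) (extendSeq e) i) := fun i hi =>
    not_lt.1 fun h => Nat.find_min he hi ⟨SeqIdx.lt_of_lt hi hnN.le, h⟩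
  refine ⟨⟨Nat.find he + 1, Order.add_one_le_of_lt hnN⟩,
    ⟨cap (extendSeq a) (extendSeq e) (Nat.find he), ?_⟩, ?_⟩
  · exact (SeqIdx.lt_of_le (cap_le _ _ _) hnN).le
  · rw [connectionMatrix_apply]
    exact newtonCoeff_cap_neg (monotoneOn_extendSeq ha hnN.le) hmin hn

theorem theorem1p2 (N : ℕ∞) (a e : SeqIdx N → ℝ) (ha : Monotone a) :
    (IsTotallyNonneg (connectionMatrix a e) ↔ IsRestrictedGrowth a e) ∧
      (¬ IsRestrictedGrowth a e → ∃ m k : MatIdx N, connectionMatrix a e m k < 0) := by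
  refine ⟨⟨fun h => ?_, fun h => h.isTotallyNonneg ha⟩, exists_connectionMatrix_neg ha⟩
  by_contra he
  obtain ⟨m, k, hmk⟩ := exists_connectionMatrix_neg ha he
  have := h 1 (fun _ => m) (fun _ => k) (Subsingleton.strictMono _) (Subsingleton.strictMono _)
  simp only [Matrix.det_unique, Matrix.submatrix_apply] at this
  exact this.not_gt hmk
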